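/- A quantum set $\mathcal X$ is given by a set $\mathrm{At}(\mathcal X)$ of nonzero finite-dimensional complex Hilbert spaces, its atoms. A binary relation $R$ from $\mathcal X$ to $\mathcal Y$ assigns to all atoms $X$ of $\mathcal X$ and $Y$ of $\mathcal Y$ a subspace $R(X,Y)$ of the space $L(X,Y)$ of linear operators. Composition is $(S\circ R)(X,Z)=\mathrm{span}\{sr \mid s\in S(Y,Z),\ r\in R(X,Y),\ Y\in\mathrm{At}(\mathcal Y)\}$, the adjoint is $R^\dagger(Y,X)=\{r^\dagger\mid r\in R(X,Y)\}$, the identity has $I_{\mathcal X}(X,X)=\mathbb C\cdot 1_X$ and other components $0$, and $\le$ is atomwise inclusion of subspaces. A function $F\colon\mathcal X\to\mathcal Y$ is a binary relation with $F^\dagger\circ F\ge I_{\mathcal X}$ and $F\circ F^\dagger\le I_{\mathcal Y}$; it is injective if $F^\dagger\circ F\le I_{\mathcal X}$. Quantum sets and functions form the category $\mathbf{qSet}$. The quantum set $\mathbf 1$ with the single atom $\mathbb C$ is a terminal object, $\mathcal X\uplus\mathcal Y$ denotes the disjoint union (the coproduct), and $T\colon\mathbf 1\to\mathbf 1\uplus\mathbf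 1$ is the inclusion of the second summand. The Cartesian product $\mathcal X\times\mathcal Y$ has the atoms $X\otimes Y$ for atoms $X$ of $\mathcal X$ and $Y$ of $\mathcal Y$. For relations $R_1,R_2$, the component of $R_1\times R_2$ from $X_1\otimes X_2$ to $Y_1\otimes Y_2$ is $\mathrm{span}\{r_1\otimes r_2\mid r_i\in R_i(X_i,Y_i)\}$. The projections are $P_1=U\circ(I_{\mathcal X}\times{!})\colon\mathcal X\times\mathcal Y\to\mathcal X$ and $P_2=U\circ({!}\times I_{\mathcal Y})\colon\mathcal X\times\mathcal Y\to\mathcal Y$, where $!$ is the unique function to $\mathbf 1$ and $U$ is the right or left unitor, whose nonzero components are spanned by the canonical identifications $X\otimes\mathbb C\cong X$ or $\mathbb C\otimes Y\cong Y$. A function $F\colon\mathcal X\to\mathcal Y$ is classical if there is a function $G\colon\mathcal X\to\mathcal Y\times\mathcal X$ with $P_1\circ G=F$ and $P_2\circ G=I_{\mathcal X}$. Then: 1. For every injective function $J\colon\mathcal Z\rightarrowtail\mathcal X$ there is a unique classical function $F\colon\mathcal X\to\mathbf 1\uplus\mathbf 1$ such that $$\begin{array}{ccc}\mathcal Z&\longrightarrow&\mathbf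 1\\ {\scriptstyle J}\downarrow&&\downarrow{\scriptstyle T}\\ \mathcal X&\underset{F}{\longrightarrow}&\mathbf 1\uplus\mathbf 1\end{array}$$ is a pullback square in $\mathbf{qSet}$, where the top arrow is the unique function from $\mathcal Z$ to $\mathbf 1$. 2. Consequently, subobjects are classified by classical functions to $\mathbf 1\uplus\mathbf 1$: for every quantum set $\mathcal X$ there is a bijection $S\mapsto F_S$ from the subobjects of $\mathcal X$ in $\mathbf{qSet}$ (equivalence classes of monomorphisms into $\mathcal X$) to the classical functions $\mathcal X\to\mathbf 1\uplus\mathbf 1$, such that for every subobject $S$, represented by $J\colon\mathcal Z\to\mathcal X$, the square above with $F=F_S$ is a pullback. -/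

import Mathlib

open CategoryTheory CategoryTheory.Limits
open scoped TensorProduct

universe u v

noncomputable section

/-- A quantum set: a family of nonzero finite-dimensional complex Hilbert spaces, its atoms,
indexed by the type `At`. A set of Hilbert spaces is a family indexed by itself; distinct indices
count as distinct atoms, so that disjoint unions and Cartesian products need no renaming. -/
structure QuantumSet : Type (max (u + 1) (v + 1)) where
  At : Type u
  space : At → Type v
  [normed : ∀ i, NormedAddCommGroup (space i)]
  [hilbert : ∀ i, InnerProductSpace ℂ (space i)]
  [finite : ∀ i, FiniteDimensional ℂ (space i)]
  [nontrivial : ∀ i, Nontrivial (space i)]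

namespace QuantumSet

attribute [instance] QuantumSet.normed QuantumSet.hilbert QuantumSet.finite QuantumSet.nontrivial

/-- A binary relation from `X` to `Y`: a subspace of `L(X i, Y j)` for each pair of atoms
(every linear operator between finite-dimensional spaces is bounded).
The order on binary relations is the atomwise inclusion of subspaces. -/
abbrev Rel (X Y : QuantumSet.{u, v}) : Type (max u v) :=
  ∀ (i : X.At) (j : Y.At), Submodule ℂ (X.space i →ₗ[ℂ] Y.space j)

/-- The identity operator, from an atom to itself. -/
def atomId (X : QuantumSet.{u, v}) {i j : X.At} (h : i = j) : X.space i →ₗ[ℂ] X.space j :=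
  h ▸ LinearMap.id

namespace Rel

variable {W X Y Z : QuantumSet.{u, v}}

/-- The identity relation: `ℂ · 1` on the diagonal and `0` elsewhere. -/
def id (X : QuantumSet.{u, v}) : Rel X X := fun i j =>
  Submodule.span ℂ {t | ∃ h : i = j, t = X.atomId h}

/-- The composition `S ∘ R`. -/
def comp (S : Rel Y Z) (R : Rel X Y) : Rel X Z := fun i k =>
  Submodule.span ℂ {t | ∃ j, ∃ s ∈ S j k, ∃ r ∈ R i j, t = s ∘ₗ r}

/-- The adjoint relation `R†`, consisting of the Hermitian adjoints. -/
def dagger (R : Rel X Y) : Rel Y X := fun j i =>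
  (R i j).map (LinearMap.adjoint (𝕜 := ℂ) (E := X.space i) (F := Y.space j)).toLinearMap

/-- `R` is a function: `R† ∘ R ≥ I` and `R ∘ R† ≤ I`. -/
def IsFunction (R : Rel X Y) : Prop :=
  Rel.id X ≤ R.dagger.comp R ∧ R.comp R.dagger ≤ Rel.id Y

/-- `R` is injective: `R† ∘ R ≤ I`. -/
def IsInjective (R : Rel X Y) : Prop :=
  R.dagger.comp R ≤ Rel.id X

lemma comp_le_iff {S : Rel Y Z} {R : Rel X Y} {Q : Rel X Z} :
    S.comp R ≤ Q ↔ ∀ i j k, ∀ s ∈ S j k, ∀ r ∈ R i j, s ∘ₗ r ∈ Q i k := by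
  constructor
  · intro h i j k s hs r hr
    exact h i k (Submodule.subset_span ⟨j, s, hs, r, hr, rfl⟩)
  · intro h i k
    refine Submodule.span_le.2 ?_
    rintro t ⟨j, s, hs, r, hr, rfl⟩
    exact h i j k s hs r hr

lemma mem_comp {S : Rel Y Z} {R : Rel X Y} {i : X.At} {j : Y.At} {k : Z.At}
    {s : Y.space j →ₗ[ℂ] Z.space k} {r : X.space i →ₗ[ℂ] Y.space j}
    (hs : s ∈ S j k) (hr : r ∈ R i j) : s ∘ₗ r ∈ S.comp R i k :=
  Submodule.subset_span ⟨j, s, hs, r, hr, rfl⟩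

lemma id_le_iff {Q : Rel X X} : Rel.id X ≤ Q ↔ ∀ i, LinearMap.id ∈ Q i i := by
  constructor
  · intro h i
    exact h i i (Submodule.subset_span ⟨rfl, rfl⟩)
  · intro h i j
    refine Submodule.span_le.2 ?_
    rintro t ⟨rfl, rfl⟩
    exact h i

lemma id_mem (i : X.At) : (LinearMap.id : X.space i →ₗ[ℂ] X.space i) ∈ Rel.id X i i :=
  Submodule.subset_span ⟨rfl, rfl⟩

lemma comp_mono {S S' : Rel Y Z} {R R' : Rel X Y} (hS : S ≤ S') (hR : R ≤ R') :
    S.comp R ≤ S'.comp R' :=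
  comp_le_iff.2 fun _ _ _ _ hs _ hr => mem_comp (hS _ _ hs) (hR _ _ hr)

lemma comp_assoc (T : Rel Y Z) (S : Rel X Y) (R : Rel W X) :
    (T.comp S).comp R = T.comp (S.comp R) := by
  apply le_antisymm
  · refine comp_le_iff.2 fun i j l p hp r hr => ?_
    induction hp using Submodule.span_induction with
    | mem p hp =>
      obtain ⟨k, t, ht, s, hs, rfl⟩ := hp
      rw [LinearMap.comp_assoc]
      exact mem_comp ht (mem_comp hs hr)
    | zero => rw [LinearMap.zero_comp]; exact zero_mem _
    | add p q _ _ hp hq => rw [LinearMap.add_comp]; exact add_mem hp hq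
    | smul c p _ hp => rw [LinearMap.smul_comp]; exact Submodule.smul_mem _ _ hp
  · refine comp_le_iff.2 fun i j l t ht p hp => ?_
    induction hp using Submodule.span_induction with
    | mem p hp =>
      obtain ⟨k, s, hs, r, hr, rfl⟩ := hp
      rw [← LinearMap.comp_assoc]
      exact mem_comp (mem_comp ht hs) hr
    | zero => rw [LinearMap.comp_zero]; exact zero_mem _
    | add p q _ _ hp hq => rw [LinearMap.comp_add]; exact add_mem hp hq
    | smul c p _ hp => rw [LinearMap.comp_smul]; exact Submodule.smul_mem _ _ hp

lemma comp_id (R : Rel X Y) : R.comp (Rel.id X) = R := by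
  apply le_antisymm
  · refine comp_le_iff.2 fun i j l t ht p hp => ?_
    induction hp using Submodule.span_induction with
    | mem p hp =>
      obtain ⟨rfl, rfl⟩ := hp
      exact ht
    | zero => rw [LinearMap.comp_zero]; exact zero_mem _
    | add p q _ _ hp hq => rw [LinearMap.comp_add]; exact add_mem hp hq
    | smul c p _ hp => rw [LinearMap.comp_smul]; exact Submodule.smul_mem _ _ hp
  · exact fun i j t ht => mem_comp ht (id_mem i)

lemma id_comp (R : Rel X Y) : (Rel.id Y).comp R = R := by
  apply le_antisymm
  · refine comp_le_iff.2 fun i j l p hp t ht => ?_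
    induction hp using Submodule.span_induction with
    | mem p hp =>
      obtain ⟨rfl, rfl⟩ := hp
      exact ht
    | zero => rw [LinearMap.zero_comp]; exact zero_mem _
    | add p q _ _ hp hq => rw [LinearMap.add_comp]; exact add_mem hp hq
    | smul c p _ hp => rw [LinearMap.smul_comp]; exact Submodule.smul_mem _ _ hp
  · exact fun i j t ht => mem_comp (id_mem j) ht

lemma adjoint_mem_dagger {R : Rel X Y} {i : X.At} {j : Y.At}
    {r : X.space i →ₗ[ℂ] Y.space j} (hr : r ∈ R i j) :
    LinearMap.adjoint r ∈ R.dagger j i :=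
  Submodule.mem_map_of_mem hr

lemma dagger_le_iff {R : Rel X Y} {Q : Rel Y X} :
    R.dagger ≤ Q ↔ ∀ i j, ∀ r ∈ R i j, LinearMap.adjoint r ∈ Q j i := by
  constructor
  · exact fun h i j r hr => h j i (adjoint_mem_dagger hr)
  · rintro h j i _ ⟨r, hr, rfl⟩
    exact h i j r hr

lemma dagger_dagger (R : Rel X Y) : R.dagger.dagger = R := by
  apply le_antisymm
  · refine dagger_le_iff.2 ?_
    rintro j i _ ⟨r, hr, rfl⟩
    simpa using hr
  · intro i j r hr
    have := adjoint_mem_dagger (adjoint_mem_dagger hr)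
    simpa using this

lemma dagger_mono {R S : Rel X Y} (h : R ≤ S) : R.dagger ≤ S.dagger :=
  dagger_le_iff.2 fun i j _ hr => adjoint_mem_dagger (h i j hr)

lemma dagger_comp (S : Rel Y Z) (R : Rel X Y) :
    (S.comp R).dagger = R.dagger.comp S.dagger := by
  have key : ∀ {X Y Z : QuantumSet.{u, v}} (S : Rel Y Z) (R : Rel X Y),
      S.comp R ≤ (R.dagger.comp S.dagger).dagger := by
    intro X Y Z S R
    refine comp_le_iff.2 fun i j k s hs r hr => ?_
    have := adjoint_mem_dagger (mem_comp (adjoint_mem_dagger hr) (adjoint_mem_dagger hs))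
    simpa [LinearMap.adjoint_comp] using this
  apply le_antisymm
  · have := dagger_mono (key S R)
    rwa [dagger_dagger] at this
  · have := key R.dagger S.dagger
    rwa [dagger_dagger, dagger_dagger] at this

lemma dagger_id : (Rel.id X).dagger = Rel.id X := by
  have h := dagger_comp (Rel.id X).dagger (Rel.id X)
  rw [comp_id, dagger_dagger, comp_id] at h
  exact h.symm

lemma isFunction_id : (Rel.id X).IsFunction := by
  constructor <;> rw [dagger_id, comp_id]

lemma IsFunction.comp {S : Rel Y Z} {R : Rel X Y} (hS : S.IsFunction) (hR : R.IsFunction) :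
    (S.comp R).IsFunction := by
  constructor
  · calc Rel.id X ≤ R.dagger.comp R := hR.1
      _ = R.dagger.comp ((Rel.id Y).comp R) := by rw [id_comp]
      _ ≤ R.dagger.comp ((S.dagger.comp S).comp R) :=
          comp_mono le_rfl (comp_mono hS.1 le_rfl)
      _ = _ := by simp only [dagger_comp, comp_assoc]
  · calc (S.comp R).comp (S.comp R).dagger = S.comp ((R.comp R.dagger).comp S.dagger) := by
          simp only [dagger_comp, comp_assoc]
      _ ≤ S.comp ((Rel.id Y).comp S.dagger) := comp_mono le_rfl (comp_mono hR.2 le_rfl)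
      _ = S.comp S.dagger := by rw [id_comp]
      _ ≤ Rel.id Z := hS.2

end Rel

/-- A function from the quantum set `X` to the quantum set `Y`. -/
@[ext] structure Fun (X Y : QuantumSet.{u, v}) : Type (max u v) where
  rel : Rel X Y
  isFunction : rel.IsFunction

/-- The category `qSet` of quantum sets and functions. -/
instance qSet : Category.{max u v} QuantumSet.{u, v} where
  Hom X Y := Fun X Y
  id X := ⟨Rel.id X, Rel.isFunction_id⟩
  comp F G := ⟨G.rel.comp F.rel, G.isFunction.comp F.isFunction⟩
  id_comp F := Fun.ext (Rel.comp_id F.rel)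
  comp_id F := Fun.ext (Rel.id_comp F.rel)
  assoc F G H := Fun.ext (Rel.comp_assoc H.rel G.rel F.rel).symm

/-- The underlying binary relation of a morphism of `qSet`. -/
def rel {X Y : QuantumSet.{u, v}} (F : X ⟶ Y) : Rel X Y := Fun.rel F

/-- Injective functions. -/
def IsInjective {X Y : QuantumSet.{u, v}} (F : X ⟶ Y) : Prop := (rel F).IsInjective

/-- The quantum set `𝟏`, whose only atom is the one-dimensional Hilbert space `ℓ²({*})`. -/
def one : QuantumSet.{u, v} where
  At := PUnit.{u + 1}
  space _ := EuclideanSpace ℂ PUnit.{v + 1}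

/-- The canonical identification `z ↦ z(*)` of the atom `ℓ²({*})` of `𝟏` with `ℂ`. -/
def coord (i : one.{u, v}.At) : one.{u, v}.space i →ₗ[ℂ] ℂ :=
  (EuclideanSpace.proj PUnit.unit : EuclideanSpace ℂ PUnit.{v + 1} →L[ℂ] ℂ).toLinearMap

lemma coord_injective (i : one.{u, v}.At) : Function.Injective (coord i) := by
  intro x y h
  exact PiLp.ext fun _ => h

lemma coord_single (i : one.{u, v}.At) :
    coord i (EuclideanSpace.single PUnit.unit (1 : ℂ)) = 1 := by
  change (EuclideanSpace.single PUnit.unit (1 : ℂ) : EuclideanSpace ℂ PUnit.{v + 1})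
    PUnit.unit = 1
  simp

instance : Subsingleton one.{u, v}.At := inferInstanceAs (Subsingleton PUnit)

lemma one_eq_smul_id {i j : one.{u, v}.At} (t : one.{u, v}.space i →ₗ[ℂ] one.{u, v}.space j) :
    ∃ c : ℂ, t = c • one.{u, v}.atomId (Subsingleton.elim i j) := by
  let w : one.{u, v}.space i := EuclideanSpace.single PUnit.unit 1
  refine ⟨coord j (t w), ?_⟩
  ext x
  have hx : x = coord i x • w := by
    apply coord_injective
    rw [map_smul, coord_single, smul_eq_mul, mul_one]
  apply coord_injective
  have : coord j ((one.{u, v}.atomId (Subsingleton.elim i j)) x) = coord i x := rfl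
  rw [LinearMap.smul_apply, map_smul, this]
  conv_lhs => rw [hx]
  simp [mul_comm]

/-- The largest binary relation from `X` to `𝟏`, with components `L(X i, ℓ²({*}))`. -/
def Rel.toOne (X : QuantumSet.{u, v}) : Rel X one := fun _ _ => ⊤

lemma Rel.isFunction_toOne (X : QuantumSet.{u, v}) : (Rel.toOne X).IsFunction := by
  refine ⟨id_le_iff.2 fun i => ?_, comp_le_iff.2 fun i j k s _ r _ => ?_⟩
  · let o : one.{u, v}.At := PUnit.unit
    let w : one.{u, v}.space o := EuclideanSpace.single PUnit.unit 1
    let e := stdOrthonormalBasis ℂ (X.space i)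
    let a := fun k => (coord o).smulRight (e k)
    have ha : ∀ k x, coord o (LinearMap.adjoint (a k) x) = inner ℂ (e k) x := by
      intro k x
      have h : coord o (LinearMap.adjoint (a k) x) =
          inner ℂ w (LinearMap.adjoint (a k) x) := by
        exact ((EuclideanSpace.inner_single_left PUnit.unit (1 : ℂ) _).trans (by simp; rfl)).symm
      rw [h, LinearMap.adjoint_inner_right]
      have h' : a k w = e k := by
        rw [LinearMap.smulRight_apply, coord_single, one_smul]
      rw [h']
    have hid : (LinearMap.id : X.space i →ₗ[ℂ] X.space i) =
        ∑ k, a k ∘ₗ LinearMap.adjoint (a k) := by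
      ext x
      simp only [LinearMap.id_apply, LinearMap.sum_apply, LinearMap.comp_apply]
      conv_lhs => rw [← e.sum_repr' x]
      refine Finset.sum_congr rfl fun k _ => ?_
      rw [← ha]
      rfl
    rw [hid]
    refine Submodule.sum_mem _ fun k _ => ?_
    refine mem_comp (j := o) ?_ Submodule.mem_top
    have := adjoint_mem_dagger (R := Rel.toOne X) (i := i) (j := o)
      (r := LinearMap.adjoint (a k)) Submodule.mem_top
    rwa [LinearMap.adjoint_adjoint] at this
  · obtain ⟨c, hc⟩ := one_eq_smul_id (s ∘ₗ r)
    rw [hc]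
    exact Submodule.smul_mem _ _ (Submodule.subset_span ⟨_, rfl⟩)

lemma Rel.IsFunction.eq_toOne {X : QuantumSet.{u, v}} {R : Rel X one} (hR : R.IsFunction) :
    R = Rel.toOne X := by
  refine le_antisymm (fun _ _ => le_top) fun i j f _ => ?_
  have h : ∀ p ∈ R.dagger.comp R i i, f ∘ₗ p ∈ R i j := by
    intro p hp
    induction hp using Submodule.span_induction with
    | mem p hp =>
      obtain ⟨k, s, _, r, hr, rfl⟩ := hp
      obtain ⟨c, hc⟩ := one_eq_smul_id (f ∘ₗ s)
      rw [← LinearMap.comp_assoc, hc, LinearMap.smul_comp]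
      exact Submodule.smul_mem _ _ hr
    | zero => rw [LinearMap.comp_zero]; exact zero_mem _
    | add p q _ _ hp hq => rw [LinearMap.comp_add]; exact add_mem hp hq
    | smul c p _ hp => rw [LinearMap.comp_smul]; exact Submodule.smul_mem _ _ hp
  exact h _ (id_le_iff.1 hR.1 i)

/-- `𝟏` is a terminal object of `qSet`. -/
def isTerminalOne : IsTerminal one.{u, v} :=
  IsTerminal.ofUniqueHom (fun X => (⟨Rel.toOne X, Rel.isFunction_toOne X⟩ : Fun X one))
    fun _ F => Fun.ext (Fun.isFunction F).eq_toOne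

/-- The disjoint union `X ⊎ Y`, which is the coproduct. -/
def sum (X Y : QuantumSet.{u, v}) : QuantumSet.{u, v} where
  At := X.At ⊕ Y.At
  space
    | Sum.inl i => X.space i
    | Sum.inr j => Y.space j
  normed
    | Sum.inl i => X.normed i
    | Sum.inr j => Y.normed j
  hilbert
    | Sum.inl i => X.hilbert i
    | Sum.inr j => Y.hilbert j
  finite
    | Sum.inl i => X.finite i
    | Sum.inr j => Y.finite j
  nontrivial
    | Sum.inl i => X.nontrivial i
    | Sum.inr j => Y.nontrivial j

/-- The inclusion of the second summand: `ℂ · 1` from each atom of `Y` to its copy in `X ⊎ Y`,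
and `0` elsewhere. -/
def Rel.inr (X Y : QuantumSet.{u, v}) : Rel Y (X.sum Y) := fun j k =>
  match k with
  | Sum.inl _ => ⊥
  | Sum.inr k => Rel.id Y j k

lemma Rel.isFunction_inr (X Y : QuantumSet.{u, v}) : (Rel.inr X Y).IsFunction := by
  refine ⟨id_le_iff.2 fun i => ?_, comp_le_iff.2 fun k j l s hs r hr => ?_⟩
  · have h1 : (LinearMap.id : Y.space i →ₗ[ℂ] Y.space i) ∈ Rel.inr X Y i (Sum.inr i) := id_mem i
    have h2 := mem_comp (S := (Rel.inr X Y).dagger) (R := Rel.inr X Y) (j := Sum.inr i)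
      (adjoint_mem_dagger h1) h1
    have h3 : LinearMap.adjoint (LinearMap.id : Y.space i →ₗ[ℂ] Y.space i) = LinearMap.id :=
      LinearMap.adjoint_id
    exact h3 ▸ h2
  · obtain ⟨r, hr, rfl⟩ := hr
    match k, l with
    | Sum.inl k, _ =>
      obtain rfl : r = 0 := hr
      simp
    | Sum.inr k, Sum.inl l =>
      obtain rfl : s = 0 := hs
      simp
    | Sum.inr k, Sum.inr l =>
      have h1 := mem_comp (X := Y) (Y := Y) (Z := Y) (R := (Rel.id Y).dagger) (S := Rel.id Y) hs
        (adjoint_mem_dagger hr)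
      rw [dagger_id, comp_id] at h1
      have h2 : Rel.id Y k l ≤ (Rel.id (X.sum Y) (Sum.inr k) (Sum.inr l) :
          Submodule ℂ (Y.space k →ₗ[ℂ] Y.space l)) := by
        refine Submodule.span_le.2 ?_
        rintro t ⟨rfl, rfl⟩
        exact id_mem (X := X.sum Y) (Sum.inr k)
      exact h2 h1

/-- The injection of the second summand into `X ⊎ Y`, as a morphism of `qSet`. -/
def inr (X Y : QuantumSet.{u, v}) : Y ⟶ X.sum Y :=
  (⟨Rel.inr X Y, Rel.isFunction_inr X Y⟩ : Fun Y (X.sum Y))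

/-- The Cartesian product `X × Y`, whose atoms are the tensor products of an atom of `X`
and an atom of `Y`. -/
def prod (X Y : QuantumSet.{u, v}) : QuantumSet.{u, v} where
  At := X.At × Y.At
  space p := X.space p.1 ⊗[ℂ] Y.space p.2

/-- The Cartesian product of binary relations. -/
def Rel.prod {X₁ X₂ Y₁ Y₂ : QuantumSet.{u, v}} (R₁ : Rel X₁ Y₁) (R₂ : Rel X₂ Y₂) :
    Rel (X₁.prod X₂) (Y₁.prod Y₂) := fun p q =>
  Submodule.span ℂ {t | ∃ r₁ ∈ R₁ p.1 q.1, ∃ r₂ ∈ R₂ p.2 q.2, t = TensorProduct.map r₁ r₂}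

/-- The operator `x ⊗ z ↦ z(*) • x`. -/
def rightUnit (X : QuantumSet.{u, v}) (p : (X.prod one).At) :
    (X.prod one).space p →ₗ[ℂ] X.space p.1 :=
  (TensorProduct.rid ℂ (X.space p.1)).toLinearMap ∘ₗ
    TensorProduct.map (LinearMap.id : X.space p.1 →ₗ[ℂ] X.space p.1) (coord p.2)

/-- The operator `z ⊗ x ↦ z(*) • x`. -/
def leftUnit (X : QuantumSet.{u, v}) (p : (one.prod X).At) :
    (one.prod X).space p →ₗ[ℂ] X.space p.2 :=
  (TensorProduct.lid ℂ (X.space p.2)).toLinearMap ∘ₗ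
    TensorProduct.map (coord p.1) (LinearMap.id : X.space p.2 →ₗ[ℂ] X.space p.2)

/-- The right unitor `X × 𝟏 → X`. -/
def Rel.rightUnitor (X : QuantumSet.{u, v}) : Rel (X.prod one) X := fun p i =>
  Submodule.span ℂ {t | ∃ h : p.1 = i, t = X.atomId h ∘ₗ X.rightUnit p}

/-- The left unitor `𝟏 × X → X`. -/
def Rel.leftUnitor (X : QuantumSet.{u, v}) : Rel (one.prod X) X := fun p i =>
  Submodule.span ℂ {t | ∃ h : p.2 = i, t = X.atomId h ∘ₗ X.leftUnit p}

/-- The projection `P₁` from `X × Y` to `X`: the unitor after `I × !`. -/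
def Rel.fst (X Y : QuantumSet.{u, v}) : Rel (X.prod Y) X :=
  (Rel.rightUnitor X).comp ((Rel.id X).prod (rel (isTerminalOne.from Y)))

/-- The projection `P₂` from `X × Y` to `Y`: the unitor after `! × I`. -/
def Rel.snd (X Y : QuantumSet.{u, v}) : Rel (X.prod Y) Y :=
  (Rel.leftUnitor Y).comp (Rel.prod (rel (isTerminalOne.from X)) (Rel.id Y))

/-- `F₁` and `F₂` are compatible: they are the components of a single function to the
Cartesian product. -/
def Compatible {X Y₁ Y₂ : QuantumSet.{u, v}} (F₁ : X ⟶ Y₁) (F₂ : X ⟶ Y₂) : Prop :=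
  ∃ F : X ⟶ Y₁.prod Y₂,
    (Rel.fst Y₁ Y₂).comp (rel F) = rel F₁ ∧ (Rel.snd Y₁ Y₂).comp (rel F) = rel F₂

/-- A function is classical if it is compatible with the identity function. -/
def IsClassical {X Y : QuantumSet.{u, v}} (F : X ⟶ Y) : Prop := Compatible F (𝟙 X)

end QuantumSet

end

/-! Everything reduces to sets of atoms. For a function `J` into `X`, `J ∘ J†` lies below the
identity, so its component at each atom is `0` or `ℂ · 1`. The atoms of the second kind form the
support of `J`. If `J` is injective, a function `H` into `X` factors through `J` exactly when its
support lies in that of `J`, the factor being `J† ∘ H`. So injective functions into `X` correspond,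
up to isomorphism, to sets of atoms (`IsInjective.exists_lift`, `support_incl`).

Classical functions to `𝟏 ⊎ 𝟏` are also sets of atoms. The atoms of the target are one-dimensional,
so a function compatible with the identity sends each atom of `X` wholly to one of the two
(`IsClassical.exists_eq_ofAtoms`). The square with the indicator of `A` commutes for `H` exactly
when the support of `H` lies in `A`. Hence the pullback of `T` along that indicator is the inclusion
of `A`, which gives existence and uniqueness.

The second claim also needs every monomorphism `J` to be injective (`isInjective_of_mono`). The
components of `J† ∘ J` form a system of operators closed under products and adjoints. A similitude
`t` in it satisfies `J ∘ t ≤ J`, so cancelling `J` makes `t` scalar and diagonal. Cayley transforms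
reduce arbitrary elements to this case. -/

noncomputable section

namespace QuantumSet

/-! ### Similitudes and the Cayley transform -/

section LinearAlgebra

/-- Operators into a fixed nonzero space separate points. -/
lemma eq_zero_of_forall_comp_eq_zero {V W E : Type*} [NormedAddCommGroup V]
    [InnerProductSpace ℂ V] [NormedAddCommGroup W] [InnerProductSpace ℂ W]
    [AddCommGroup E] [Module ℂ E] [Nontrivial E]
    (h : V →ₗ[ℂ] W) (hh : ∀ φ : W →ₗ[ℂ] E, φ ∘ₗ h = 0) : h = 0 := by
  obtain ⟨e, he⟩ := exists_ne (0 : E)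
  ext v
  have h1 := LinearMap.congr_fun (hh ((innerₛₗ ℂ (h v)).smulRight e)) v
  simpa [he] using h1

variable {V W : Type*} [NormedAddCommGroup V] [InnerProductSpace ℂ V] [FiniteDimensional ℂ V]
  [NormedAddCommGroup W] [InnerProductSpace ℂ W] [FiniteDimensional ℂ W]

lemma adjoint_comp_self_eq_zero {r : V →ₗ[ℂ] W} (h : LinearMap.adjoint r ∘ₗ r = 0) : r = 0 := by
  ext v
  have h1 : inner ℂ (r v) (r v) = (0 : ℂ) := by
    rw [← LinearMap.adjoint_inner_right, ← LinearMap.comp_apply, h]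
    simp
  simpa using h1

lemma comp_adjoint_self_eq_zero {r : V →ₗ[ℂ] W} (h : r ∘ₗ LinearMap.adjoint r = 0) : r = 0 := by
  have h1 := adjoint_comp_self_eq_zero (r := LinearMap.adjoint r) (by simpa using h)
  simpa using h1

/-- A surjective nonzero multiple of an isometry. -/
structure IsSimilitude (t : V →ₗ[ℂ] W) : Prop where
  adjoint_comp : ∃ c : ℂ, c ≠ 0 ∧ LinearMap.adjoint t ∘ₗ t = c • LinearMap.id
  surjective : Function.Surjective t

lemma IsSimilitude.id : IsSimilitude (LinearMap.id : V →ₗ[ℂ] V) :=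
  ⟨⟨1, one_ne_zero, by ext; simp⟩, Function.surjective_id⟩

/-- Surjectivity transfers the scalar from `t† t` to `t t†`; the latter gives the condition `F ∘ F†
≤ I` for functions built from similitudes. -/
lemma IsSimilitude.comp_adjoint {t : V →ₗ[ℂ] W} (ht : IsSimilitude t) :
    ∃ c : ℂ, t ∘ₗ LinearMap.adjoint t = c • LinearMap.id := by
  obtain ⟨c, -, hc⟩ := ht.adjoint_comp
  refine ⟨c, ?_⟩
  ext y
  obtain ⟨x, rfl⟩ := ht.surjective y
  have := LinearMap.congr_fun hc x
  simp only [LinearMap.comp_apply, LinearMap.smul_apply, LinearMap.id_apply] at this ⊢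
  rw [this, map_smul]

/-- A self-adjoint operator has only real eigenvalues, so `i` is not one of them. -/
lemma sub_I_injective {a : V →ₗ[ℂ] V} (ha : LinearMap.adjoint a = a) :
    Function.Injective (a - Complex.I • LinearMap.id : V →ₗ[ℂ] V) := by
  rw [injective_iff_map_eq_zero]
  intro x hx
  have hx' : a x = Complex.I • x := by
    simpa [sub_eq_zero] using hx
  by_contra h0
  have hs : a.IsSymmetric := (LinearMap.isSymmetric_iff_isSelfAdjoint a).2 ha
  have := hs.conj_eigenvalue_eq_self (μ := Complex.I)
    (Module.End.hasEigenvalue_of_hasEigenvector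
      (x := x) ⟨Module.End.mem_eigenspace_iff.2 hx', h0⟩)
  rw [Complex.conj_I, neg_eq_iff_add_eq_zero] at this
  simp [← two_mul] at this

/-- The Cayley transform of a self-adjoint operator `a` is a unitary operator `u` with
`u (a - i) = a + i`. -/
lemma exists_cayley {a : V →ₗ[ℂ] V} (ha : LinearMap.adjoint a = a) :
    ∃ u : V →ₗ[ℂ] V, IsSimilitude u ∧
      u ∘ₗ (a - Complex.I • LinearMap.id) = a + Complex.I • LinearMap.id := by
  have hm := sub_I_injective ha
  let e := LinearEquiv.ofInjectiveEndo _ hm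
  let m : V →ₗ[ℂ] V := a - Complex.I • LinearMap.id
  let p : V →ₗ[ℂ] V := a + Complex.I • LinearMap.id
  have hem : ∀ x, m (e.symm x) = x := fun x => e.apply_symm_apply x
  have hme : ∀ x, e.symm (m x) = x := fun x => e.symm_apply_apply x
  -- Both sides equal `‖a x‖² + ‖x‖²`: the cross terms cancel because `a` is self-adjoint.
  have hnorm : ∀ x, inner ℂ (p x) (p x) = (inner ℂ (m x) (m x) : ℂ) := by
    intro x
    have h1 : inner ℂ (a x) x = (inner ℂ x (a x) : ℂ) := by
      conv_lhs => rw [← ha]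
      rw [LinearMap.adjoint_inner_left]
    simp only [p, m, LinearMap.add_apply, LinearMap.sub_apply, LinearMap.smul_apply,
      LinearMap.id_apply, inner_add_left, inner_add_right, inner_sub_left, inner_sub_right,
      inner_smul_left, inner_smul_right, h1, Complex.conj_I]
    ring
  have hu : LinearMap.adjoint (p ∘ₗ e.symm.toLinearMap) ∘ₗ (p ∘ₗ e.symm.toLinearMap) =
      LinearMap.id := by
    rw [← sub_eq_zero]
    -- Over `ℂ` an operator with vanishing quadratic form is zero, so preserving norms is enough.
    rw [← inner_map_self_eq_zero]
    intro x
    simp only [LinearMap.sub_apply, LinearMap.comp_apply, LinearMap.id_apply, inner_sub_left,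
      LinearMap.adjoint_inner_left]
    have := hnorm (e.symm x)
    rw [hem] at this
    exact sub_eq_zero.2 this
  refine ⟨p ∘ₗ e.symm.toLinearMap, ⟨⟨1, one_ne_zero, by rw [hu, one_smul]⟩, ?_⟩, ?_⟩
  · refine LinearMap.injective_iff_surjective.1 ?_
    exact Function.LeftInverse.injective (g := LinearMap.adjoint (p ∘ₗ e.symm.toLinearMap))
      fun x => LinearMap.congr_fun hu x
  · ext x
    exact congrArg p (hme x)

end LinearAlgebra

variable {W X Y Z : QuantumSet.{u, v}}

/-! ### Relations spanned by one operator per atom -/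

namespace Rel

lemma mem_id_self {i : X.At} {t : X.space i →ₗ[ℂ] X.space i} :
    t ∈ Rel.id X i i ↔ ∃ c : ℂ, t = c • LinearMap.id := by
  have : {t | ∃ h : i = i, t = X.atomId h} = {(LinearMap.id : X.space i →ₗ[ℂ] X.space i)} := by
    ext t
    exact ⟨fun ⟨_, h⟩ => h, fun h => ⟨rfl, h⟩⟩
  rw [Rel.id, this, Submodule.mem_span_singleton]
  exact ⟨fun ⟨c, h⟩ => ⟨c, h.symm⟩, fun ⟨c, h⟩ => ⟨c, h.symm⟩⟩

lemma eq_zero_of_mem_id {i j : X.At} (hij : i ≠ j) {t : X.space i →ₗ[ℂ] X.space j}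
    (ht : t ∈ Rel.id X i j) : t = 0 := by
  have : Rel.id X i j ≤ ⊥ := Submodule.span_le.2 (by rintro t ⟨h, -⟩; exact absurd h hij)
  exact this ht

/-- Functions are discretely ordered. -/
lemma IsFunction.eq_of_le {R S : Rel X Y} (hR : R.IsFunction) (hS : S.IsFunction) (h : R ≤ S) :
    R = S := by
  refine le_antisymm h ?_
  calc S = S.comp (Rel.id X) := (comp_id S).symm
    _ ≤ S.comp (R.dagger.comp R) := comp_mono le_rfl hR.1
    _ ≤ S.comp (S.dagger.comp R) := comp_mono le_rfl (comp_mono (dagger_mono h) le_rfl)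
    _ = (S.comp S.dagger).comp R := (comp_assoc _ _ _).symm
    _ ≤ (Rel.id Y).comp R := comp_mono hS.2 le_rfl
    _ = R := id_comp R

/-- The relation spanned by one operator `U w` out of each atom `w`. -/
def ofMaps (f : W.At → X.At) (U : ∀ w, W.space w →ₗ[ℂ] X.space (f w)) : Rel W X := fun w x =>
  Submodule.span ℂ {t | ∃ h : f w = x, t = X.atomId h ∘ₗ U w}

section ofMaps

variable {f : W.At → X.At} {U : ∀ w, W.space w →ₗ[ℂ] X.space (f w)}

lemma mem_ofMaps (w : W.At) : U w ∈ ofMaps f U w (f w) :=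
  Submodule.subset_span ⟨rfl, rfl⟩

lemma exists_smul_of_mem_ofMaps {w : W.At} {t : W.space w →ₗ[ℂ] X.space (f w)}
    (ht : t ∈ ofMaps f U w (f w)) : ∃ c : ℂ, t = c • U w := by
  have h : ofMaps f U w (f w) ≤ Submodule.span ℂ {U w} := by
    refine Submodule.span_le.2 ?_
    rintro t ⟨_, rfl⟩
    exact Submodule.subset_span rfl
  obtain ⟨c, h⟩ := Submodule.mem_span_singleton.1 (h ht)
  exact ⟨c, h.symm⟩

lemma eq_zero_of_mem_ofMaps {w : W.At} {x : X.At} (h : f w ≠ x)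
    {t : W.space w →ₗ[ℂ] X.space x} (ht : t ∈ ofMaps f U w x) : t = 0 := by
  have : ofMaps f U w x ≤ ⊥ := Submodule.span_le.2 (by rintro t ⟨h', -⟩; exact absurd h' h)
  exact this ht

/-- `U† U` a nonzero scalar gives `I ≤ F† ∘ F`, and `U U†` a scalar gives `F ∘ F† ≤ I`. Off-diagonal
terms vanish because each atom has only one target. -/
lemma isFunction_ofMaps (hU : ∀ w, IsSimilitude (U w)) : (ofMaps f U).IsFunction := by
  refine ⟨id_le_iff.2 fun w => ?_, comp_le_iff.2 fun x w x' s hs r hr => ?_⟩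
  · obtain ⟨c, hc, h⟩ := (hU w).adjoint_comp
    have h1 := mem_comp (adjoint_mem_dagger (mem_ofMaps (U := U) w)) (mem_ofMaps (U := U) w)
    rw [h] at h1
    exact (Submodule.smul_mem_iff _ hc).1 h1
  · obtain ⟨r, hr, rfl⟩ := hr
    by_cases hx : f w = x
    · by_cases hx' : f w = x'
      · subst hx
        subst hx'
        obtain ⟨a, rfl⟩ := exists_smul_of_mem_ofMaps hs
        obtain ⟨b, rfl⟩ := exists_smul_of_mem_ofMaps hr
        obtain ⟨c, hc⟩ := (hU w).comp_adjoint
        have : (a • U w) ∘ₗ LinearMap.adjoint (b • U w) =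
            (a * (starRingEnd ℂ b * c)) • LinearMap.id := by
          rw [map_smulₛₗ, LinearMap.smul_comp, LinearMap.comp_smul, hc]
          simp [smul_smul]
        exact mem_id_self.2 ⟨_, this⟩
      · rw [eq_zero_of_mem_ofMaps hx' hs]
        simp
    · rw [eq_zero_of_mem_ofMaps hx hr]
      simp

lemma isInjective_ofMaps (hU : ∀ w, IsSimilitude (U w)) (hf : Function.Injective f) :
    (ofMaps f U).IsInjective := by
  refine comp_le_iff.2 fun w x w' s hs r hr => ?_
  obtain ⟨s, hs, rfl⟩ := hs
  by_cases hx : f w = x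
  · by_cases hx' : f w' = x
    · subst hx
      obtain rfl := hf hx'
      obtain ⟨a, rfl⟩ := exists_smul_of_mem_ofMaps hs
      obtain ⟨b, rfl⟩ := exists_smul_of_mem_ofMaps hr
      obtain ⟨c, -, hc⟩ := (hU w').adjoint_comp
      have : LinearMap.adjoint (a • U w') ∘ₗ (b • U w') =
          (starRingEnd ℂ a * (b * c)) • LinearMap.id := by
        rw [map_smulₛₗ, LinearMap.smul_comp, LinearMap.comp_smul, hc]
        simp [smul_smul]
      exact mem_id_self.2 ⟨_, this⟩
    · rw [eq_zero_of_mem_ofMaps hx' hs]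
      simp
  · rw [eq_zero_of_mem_ofMaps hx hr]
    simp

end ofMaps

end Rel

/-! ### Monomorphisms are injective -/

@[simp] lemma rel_comp (F : X ⟶ Y) (G : Y ⟶ Z) : rel (F ≫ G) = (rel G).comp (rel F) := rfl

lemma isFunction_rel (F : X ⟶ Y) : (rel F).IsFunction := Fun.isFunction F

lemma hom_ext {F G : X ⟶ Y} (h : rel F = rel G) : F = G := Fun.ext h

lemma hom_ext_of_le {F G : X ⟶ Y} (h : rel F ≤ rel G) : F = G :=
  hom_ext ((isFunction_rel F).eq_of_le (isFunction_rel G) h)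

lemma IsInjective.dagger_comp {J : Z ⟶ X} (hJ : IsInjective J) :
    (rel J).dagger.comp (rel J) = Rel.id Z :=
  le_antisymm hJ (isFunction_rel J).1

lemma IsInjective.mono {J : Z ⟶ X} (hJ : IsInjective J) : Mono J := by
  refine ⟨fun {W} G H h => hom_ext ?_⟩
  have h1 := congrArg (fun K => (rel J).dagger.comp (rel K)) h
  simpa [← Rel.comp_assoc, hJ.dagger_comp, Rel.id_comp] using h1

/-- The morphism given by similitudes between atoms. -/
def ofMaps (f : W.At → X.At) (U : ∀ w, W.space w →ₗ[ℂ] X.space (f w))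
    (hU : ∀ w, IsSimilitude (U w)) : W ⟶ X :=
  (⟨Rel.ofMaps f U, Rel.isFunction_ofMaps hU⟩ : Fun W X)

/-- The test object has a single atom, a copy of `Z.space z`, mapped to `Z` once by the identity and
once by `t`. The hypothesis says that after `J` the second function lies below the first. Functions
are discretely ordered, so the two agree, and `J` can be cancelled. -/
lemma mem_id_of_mono {J : Z ⟶ X} [Mono J] {z z' : Z.At} {t : Z.space z →ₗ[ℂ] Z.space z'}
    (ht : IsSimilitude t) (h : ∀ x, ∀ r ∈ rel J z' x, r ∘ₗ t ∈ rel J z x) :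
    t ∈ Rel.id Z z z' := by
  let W : QuantumSet.{u, v} := { At := PUnit.{u + 1}, space := fun _ => Z.space z }
  let G : W ⟶ Z := ofMaps (fun _ => z) (fun _ => LinearMap.id) (fun _ => IsSimilitude.id)
  let H : W ⟶ Z := ofMaps (fun _ => z') (fun _ => t) (fun _ => ht)
  have hHG : H = G := by
    rw [← cancel_mono J]
    refine hom_ext_of_le ?_
    refine Rel.comp_le_iff.2 fun w k x s hs r hr => ?_
    by_cases hk : z' = k
    · subst hk
      obtain ⟨c, rfl⟩ := Rel.exists_smul_of_mem_ofMaps (W := W) (w := w) (f := fun _ => z')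
        (U := fun _ => t) hr
      rw [LinearMap.comp_smul]
      refine Submodule.smul_mem _ _ ?_
      exact Rel.mem_comp (R := rel G) (S := rel J) (j := z) (h x s hs)
        (Rel.mem_ofMaps (W := W) (f := fun _ => z) (U := fun _ => LinearMap.id) w)
    · rw [Rel.eq_zero_of_mem_ofMaps (W := W) (f := fun _ => z') (U := fun _ => t) hk hr]
      simp
  have h1 : t ∈ rel H PUnit.unit z' := Rel.mem_ofMaps (W := W) (f := fun _ => z')
    (U := fun _ => t) PUnit.unit
  rw [hHG] at h1
  by_cases hz : z = z'
  · subst hz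
    exact Rel.mem_id_self.2 (Rel.exists_smul_of_mem_ofMaps (W := W) (w := PUnit.unit)
      (f := fun _ => z) (U := fun _ => LinearMap.id) h1)
  · rw [Rel.eq_zero_of_mem_ofMaps (W := W) (w := PUnit.unit)
      (f := fun _ => z) (U := fun _ => LinearMap.id) hz h1]
    exact zero_mem _

/-- From `J ∘ J† ≤ I` follows `J ∘ (J† ∘ J) ≤ J`: the components of `J` absorb those of `J† ∘ J` on
the right. -/
lemma comp_mem_of_mem_dagger_comp {J : Z ⟶ X} {z z' : Z.At} {x : X.At}
    {r : Z.space z' →ₗ[ℂ] X.space x} (hr : r ∈ rel J z' x)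
    {k : Z.space z →ₗ[ℂ] Z.space z'} (hk : k ∈ (rel J).dagger.comp (rel J) z z') :
    r ∘ₗ k ∈ rel J z x := by
  have h : (rel J).comp ((rel J).dagger.comp (rel J)) ≤ rel J := by
    rw [← Rel.comp_assoc]
    exact (Rel.comp_mono (isFunction_rel J).2 le_rfl).trans_eq (Rel.id_comp _)
  exact h z x (Rel.mem_comp hr hk)

lemma adjoint_mem_dagger_comp {J : Z ⟶ X} {z z' : Z.At}
    {k : Z.space z →ₗ[ℂ] Z.space z'} (hk : k ∈ (rel J).dagger.comp (rel J) z z') :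
    LinearMap.adjoint k ∈ (rel J).dagger.comp (rel J) z' z := by
  have h := Rel.adjoint_mem_dagger hk
  rwa [Rel.dagger_comp, Rel.dagger_dagger] at h

/-- The Cayley transform `u` of `a` is a similitude under which `J` is stable, so it is scalar, and
`a` can be recovered from it. -/
lemma exists_eq_smul_id_of_adjoint_eq {J : Z ⟶ X} [Mono J] {z : Z.At}
    {a : Z.space z →ₗ[ℂ] Z.space z} (ha : a ∈ (rel J).dagger.comp (rel J) z z)
    (hsa : LinearMap.adjoint a = a) : ∃ c : ℂ, a = c • LinearMap.id := by
  obtain ⟨u, hu, hua⟩ := exists_cayley hsa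
  have hid := Rel.id_le_iff.1 (isFunction_rel J).1 z
  have key : ∀ x, ∀ r ∈ rel J z x, r ∘ₗ u ∈ rel J z x := by
    intro x
    let m : Z.space z →ₗ[ℂ] Z.space z := a - Complex.I • LinearMap.id
    -- Precomposition with `a - i` is injective on a finite-dimensional space, hence onto. So `r (a
    -- + i) = q (a - i)` for some `q` in the component, and cancelling `a - i` gives `r u = q`,
    -- without knowing that `u` itself lies in `J† ∘ J`.
    let T : rel J z x →ₗ[ℂ] rel J z x :=
      (LinearMap.lcomp ℂ (X.space x) m).restrict fun r hr =>
        comp_mem_of_mem_dagger_comp hr (sub_mem ha (Submodule.smul_mem _ _ hid))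
    have hms : Function.Surjective m :=
      LinearMap.injective_iff_surjective.1 (sub_I_injective hsa)
    have hT : Function.Injective T := by
      rintro ⟨r, hr⟩ ⟨s, hs⟩ hrs
      have h1 : r ∘ₗ m = s ∘ₗ m := congrArg Subtype.val hrs
      exact Subtype.ext ((LinearMap.cancel_right hms).1 h1)
    intro r hr
    have hTp : ∀ q ∈ rel J z x, q ∘ₗ (a + Complex.I • LinearMap.id) ∈ rel J z x := fun q hq =>
      comp_mem_of_mem_dagger_comp hq (add_mem ha (Submodule.smul_mem _ _ hid))
    obtain ⟨⟨q, hq⟩, hqr⟩ := LinearMap.injective_iff_surjective.1 hT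
      ⟨r ∘ₗ (a + Complex.I • LinearMap.id), hTp r hr⟩
    have h1 : q ∘ₗ m = r ∘ₗ (a + Complex.I • LinearMap.id) := congrArg Subtype.val hqr
    rw [← hua, ← LinearMap.comp_assoc] at h1
    rwa [← (LinearMap.cancel_right hms).1 h1]
  obtain ⟨c, rfl⟩ := Rel.mem_id_self.1 (mem_id_of_mono hu key)
  have h1 : (c - 1) • a = (Complex.I * (c + 1)) • LinearMap.id := by
    rw [LinearMap.smul_comp, LinearMap.id_comp] at hua
    have h2 : (c - 1) • a = (c • (a - Complex.I • LinearMap.id) -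
        (a + Complex.I • LinearMap.id)) + (Complex.I * (c + 1)) • LinearMap.id := by
      module
    rw [h2, hua, sub_self, zero_add]
  -- For `c = 1` the identity `h1` would read `0 = 2i` on a nonzero space.
  have hc : c - 1 ≠ 0 := by
    intro hc
    obtain ⟨v, hv⟩ := exists_ne (0 : Z.space z)
    have h2 := LinearMap.congr_fun h1 v
    rw [sub_eq_zero.1 hc] at h2
    exact hv (by simpa [← two_mul] using h2.symm)
  exact ⟨(c - 1)⁻¹ * (Complex.I * (c + 1)), by
    rw [mul_smul, ← h1, smul_smul, inv_mul_cancel₀ hc, one_smul]⟩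

/-- `J† ∘ J` is closed under adjoints, so the self-adjoint operators `a + a†` and `i (a - a†)`
belong to it and are scalar. -/
lemma exists_eq_smul_id_of_mono {J : Z ⟶ X} [Mono J] {z : Z.At}
    {a : Z.space z →ₗ[ℂ] Z.space z} (ha : a ∈ (rel J).dagger.comp (rel J) z z) :
    ∃ c : ℂ, a = c • LinearMap.id := by
  have ha' := adjoint_mem_dagger_comp ha
  obtain ⟨c, hc⟩ := exists_eq_smul_id_of_adjoint_eq (add_mem ha ha') (by
    rw [map_add, LinearMap.adjoint_adjoint, add_comm])
  obtain ⟨d, hd⟩ := exists_eq_smul_id_of_adjoint_eq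
    (Submodule.smul_mem _ Complex.I (sub_mem ha ha')) (by
      rw [map_smulₛₗ, map_sub, LinearMap.adjoint_adjoint, Complex.conj_I]
      module)
  refine ⟨(c - Complex.I * d) / 2, ?_⟩
  have h1 : a = (1 / 2 : ℂ) • ((a + LinearMap.adjoint a) -
      Complex.I • (Complex.I • (a - LinearMap.adjoint a))) := by
    rw [smul_smul, Complex.I_mul_I]
    module
  rw [h1, hc, hd]
  module

/-- The monomorphisms of `qSet` are injective. -/
lemma isInjective_of_mono (J : Z ⟶ X) [Mono J] : IsInjective J := by
  intro z z' t ht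
  by_cases h0 : t = 0
  · rw [h0]
    exact zero_mem _
  have ht' := adjoint_mem_dagger_comp ht
  -- `J† ∘ J` is closed under composition and adjoints. Thus `t† t` and `t t†` are endomorphisms in
  -- it, hence scalars, and a nonzero `t` is a similitude.
  have hK : ∀ {z₁ z₂ : Z.At} {k : Z.space z₁ →ₗ[ℂ] Z.space z₂},
      k ∈ (rel J).dagger.comp (rel J) z₁ z₂ →
      LinearMap.adjoint k ∘ₗ k ∈ (rel J).dagger.comp (rel J) z₁ z₁ := by
    intro z₁ z₂ k hk
    have h1 : ((rel J).dagger.comp (rel J)).comp ((rel J).dagger.comp (rel J)) ≤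
        (rel J).dagger.comp (rel J) := by
      rw [Rel.comp_assoc]
      refine Rel.comp_mono le_rfl ?_
      rw [← Rel.comp_assoc]
      exact (Rel.comp_mono (isFunction_rel J).2 le_rfl).trans_eq (Rel.id_comp _)
    exact h1 _ _ (Rel.mem_comp (adjoint_mem_dagger_comp hk) hk)
  obtain ⟨c, hc⟩ := exists_eq_smul_id_of_mono (hK ht)
  obtain ⟨d, hd⟩ := exists_eq_smul_id_of_mono (hK ht')
  rw [LinearMap.adjoint_adjoint] at hd
  have hc0 : c ≠ 0 := by
    rintro rfl
    exact h0 (adjoint_comp_self_eq_zero (by rw [hc, zero_smul]))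
  have hd0 : d ≠ 0 := by
    rintro rfl
    exact h0 (comp_adjoint_self_eq_zero (by rw [hd, zero_smul]))
  refine mem_id_of_mono ⟨⟨c, hc0, hc⟩, fun y => ⟨d⁻¹ • LinearMap.adjoint t y, ?_⟩⟩
    fun x r hr => comp_mem_of_mem_dagger_comp hr ht
  have := LinearMap.congr_fun hd y
  simp only [LinearMap.comp_apply, LinearMap.smul_apply, LinearMap.id_apply] at this
  rw [map_smul, this, smul_smul, inv_mul_cancel₀ hd0, one_smul]

/-! ### Cartesian products and explicit projections -/

lemma mem_submodule_of_eq {V : Type*} [AddCommGroup V] [Module ℂ V] {S : Submodule ℂ V} {s t : V}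
    (h : s = t) (ht : t ∈ S) : s ∈ S :=
  h ▸ ht

/-- The atom of the Cartesian product given by an atom of each factor. -/
def pair (i : X.At) (j : Y.At) : (X.prod Y).At := (i, j)

lemma exists_pair (p : (X.prod Y).At) : ∃ i j, p = pair i j := ⟨p.1, p.2, rfl⟩

/-- Pure tensors in an atom of the Cartesian product. -/
def tmul {i : X.At} {j : Y.At} (x : X.space i) (y : Y.space j) : (X.prod Y).space (pair i j) :=
  x ⊗ₜ[ℂ] y

lemma prod_ext {E : Type*} [AddCommGroup E] [Module ℂ E] {i : X.At} {j : Y.At}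
    {s t : (X.prod Y).space (pair i j) →ₗ[ℂ] E} (h : ∀ x y, s (tmul x y) = t (tmul x y)) :
    s = t := by
  have h' : ∀ s t : X.space i ⊗[ℂ] Y.space j →ₗ[ℂ] E,
      (∀ x y, s (x ⊗ₜ y) = t (x ⊗ₜ y)) → s = t := fun s t => TensorProduct.ext'
  exact h' s t h

/-- The operator `x ⊗ y ↦ φ y • x`. -/
def fstMap (i : X.At) (j : Y.At) (φ : Y.space j →ₗ[ℂ] ℂ) :
    (X.prod Y).space (pair i j) →ₗ[ℂ] X.space i :=
  (TensorProduct.rid ℂ (X.space i)).toLinearMap ∘ₗ TensorProduct.map LinearMap.id φ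

/-- The operator `x ⊗ y ↦ φ x • y`. -/
def sndMap (i : X.At) (j : Y.At) (φ : X.space i →ₗ[ℂ] ℂ) :
    (X.prod Y).space (pair i j) →ₗ[ℂ] Y.space j :=
  (TensorProduct.lid ℂ (Y.space j)).toLinearMap ∘ₗ TensorProduct.map φ LinearMap.id

/-- The operator `y ↦ e ⊗ y`. -/
def tmulLeft {i : X.At} (e : X.space i) (j : Y.At) :
    Y.space j →ₗ[ℂ] (X.prod Y).space (pair i j) :=
  TensorProduct.mk ℂ (X.space i) (Y.space j) e

namespace Rel

/-- The function to `𝟏` contains every operator, so after the unitor it contributes arbitrary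
functionals on the second factor, while the identity forces the first atoms to agree. -/
lemma fst_eq (X Y : QuantumSet.{u, v}) : Rel.fst X Y = fun p i =>
    Submodule.span ℂ {t | ∃ φ : Y.space p.2 →ₗ[ℂ] ℂ, ∃ h : p.1 = i,
      t = X.atomId h ∘ₗ fstMap p.1 p.2 φ} := by
  apply le_antisymm
  · refine comp_le_iff.2 fun p q i s hs r hr => ?_
    obtain ⟨p, p', rfl⟩ := exists_pair p
    obtain ⟨q, o, rfl⟩ := exists_pair q
    induction hs using Submodule.span_induction with
    | zero => rw [LinearMap.zero_comp]; exact zero_mem _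
    | add s t _ _ hs ht => rw [LinearMap.add_comp]; exact add_mem hs ht
    | smul c s _ hs => rw [LinearMap.smul_comp]; exact Submodule.smul_mem _ _ hs
    | mem s hs =>
    obtain ⟨h, rfl⟩ := hs
    obtain rfl : q = i := h
    induction hr using Submodule.span_induction with
    | zero => rw [LinearMap.comp_zero]; exact zero_mem _
    | add s t _ _ hs ht => rw [LinearMap.comp_add]; exact add_mem hs ht
    | smul c s _ hs => rw [LinearMap.comp_smul]; exact Submodule.smul_mem _ _ hs
    | mem r hr =>
    obtain ⟨r₁, hr₁, r₂, -, rfl⟩ := hr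
    by_cases hpq : p = q
    · subst hpq
      obtain ⟨c, rfl⟩ := mem_id_self.1 hr₁
      refine Submodule.subset_span ⟨c • coord o ∘ₗ r₂, rfl, prod_ext fun x y => ?_⟩
      change coord o (r₂ y) • (c • x) = (c • coord o (r₂ y)) • x
      rw [smul_smul, smul_eq_mul, mul_comm]
    · obtain rfl : r₁ = 0 := eq_zero_of_mem_id hpq hr₁
      refine mem_submodule_of_eq (prod_ext fun x y => ?_) (zero_mem _)
      change coord o (r₂ y) • (0 : X.space q) = 0
      exact smul_zero _
  · intro p i
    obtain ⟨p, p', rfl⟩ := exists_pair p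
    refine Submodule.span_le.2 ?_
    rintro t ⟨φ, h, rfl⟩
    obtain rfl : p = i := h
    let o : one.{u, v}.At := PUnit.unit
    let w : one.{u, v}.space o := EuclideanSpace.single PUnit.unit 1
    have hr : TensorProduct.map LinearMap.id (φ.smulRight w) ∈
        (Rel.id X).prod (rel (isTerminalOne.from Y)) (pair p p') (pair p o) :=
      Submodule.subset_span ⟨_, id_mem p, φ.smulRight w, Submodule.mem_top, rfl⟩
    have hs : X.rightUnit (pair p o) ∈ Rel.rightUnitor X (pair p o) p :=
      Submodule.subset_span ⟨rfl, rfl⟩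
    refine mem_submodule_of_eq (prod_ext fun x y => ?_) (mem_comp hs hr)
    -- The vector `w` has coordinate `1`, so `φ` is recovered from `φ.smulRight w`.
    change φ y • x = coord o (φ y • w) • x
    rw [map_smul, coord_single, smul_eq_mul, mul_one]

lemma fstMap_mem (i : X.At) (j : Y.At) (φ : Y.space j →ₗ[ℂ] ℂ) :
    fstMap i j φ ∈ Rel.fst X Y (pair i j) i := by
  rw [fst_eq]
  exact Submodule.subset_span ⟨φ, rfl, rfl⟩

lemma snd_eq (X Y : QuantumSet.{u, v}) : Rel.snd X Y = fun p i =>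
    Submodule.span ℂ {t | ∃ φ : X.space p.1 →ₗ[ℂ] ℂ, ∃ h : p.2 = i,
      t = Y.atomId h ∘ₗ sndMap p.1 p.2 φ} := by
  apply le_antisymm
  · refine comp_le_iff.2 fun p q i s hs r hr => ?_
    obtain ⟨p', p, rfl⟩ := exists_pair p
    obtain ⟨o, q, rfl⟩ := exists_pair q
    induction hs using Submodule.span_induction with
    | zero => rw [LinearMap.zero_comp]; exact zero_mem _
    | add s t _ _ hs ht => rw [LinearMap.add_comp]; exact add_mem hs ht
    | smul c s _ hs => rw [LinearMap.smul_comp]; exact Submodule.smul_mem _ _ hs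
    | mem s hs =>
    obtain ⟨h, rfl⟩ := hs
    obtain rfl : q = i := h
    induction hr using Submodule.span_induction with
    | zero => rw [LinearMap.comp_zero]; exact zero_mem _
    | add s t _ _ hs ht => rw [LinearMap.comp_add]; exact add_mem hs ht
    | smul c s _ hs => rw [LinearMap.comp_smul]; exact Submodule.smul_mem _ _ hs
    | mem r hr =>
    obtain ⟨r₂, -, r₁, hr₁, rfl⟩ := hr
    by_cases hpq : p = q
    · subst hpq
      obtain ⟨c, rfl⟩ := mem_id_self.1 hr₁
      refine Submodule.subset_span ⟨c • coord o ∘ₗ r₂, rfl, prod_ext fun x y => ?_⟩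
      change coord o (r₂ x) • (c • y) = (c • coord o (r₂ x)) • y
      rw [smul_smul, smul_eq_mul, mul_comm]
    · obtain rfl : r₁ = 0 := eq_zero_of_mem_id hpq hr₁
      refine mem_submodule_of_eq (prod_ext fun x y => ?_) (zero_mem _)
      change coord o (r₂ x) • (0 : Y.space q) = 0
      exact smul_zero _
  · intro p i
    obtain ⟨p', p, rfl⟩ := exists_pair p
    refine Submodule.span_le.2 ?_
    rintro t ⟨φ, h, rfl⟩
    obtain rfl : p = i := h
    let o : one.{u, v}.At := PUnit.unit
    let w : one.{u, v}.space o := EuclideanSpace.single PUnit.unit 1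
    have hr : TensorProduct.map (φ.smulRight w) LinearMap.id ∈
        Rel.prod (rel (isTerminalOne.from X)) (Rel.id Y) (pair p' p) (pair o p) :=
      Submodule.subset_span ⟨φ.smulRight w, Submodule.mem_top, _, id_mem p, rfl⟩
    have hs : Y.leftUnit (pair o p) ∈ Rel.leftUnitor Y (pair o p) p :=
      Submodule.subset_span ⟨rfl, rfl⟩
    refine mem_submodule_of_eq (prod_ext fun x y => ?_) (mem_comp hs hr)
    change φ x • y = coord o (φ x • w) • y
    rw [map_smul, coord_single, smul_eq_mul, mul_one]

lemma sndMap_mem (i : X.At) (j : Y.At) (φ : X.space i →ₗ[ℂ] ℂ) :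
    sndMap i j φ ∈ Rel.snd X Y (pair i j) j := by
  rw [snd_eq]
  exact Submodule.subset_span ⟨φ, rfl, rfl⟩

lemma eq_zero_of_mem_fst {p : (X.prod Y).At} {i : X.At} (h : p.1 ≠ i)
    {t : (X.prod Y).space p →ₗ[ℂ] X.space i} (ht : t ∈ Rel.fst X Y p i) : t = 0 := by
  have : Rel.fst X Y p i ≤ ⊥ := by
    rw [fst_eq]
    refine Submodule.span_le.2 ?_
    rintro t ⟨_, h', -⟩
    exact absurd h' h
  exact this ht

/-- The relation `X → Y` whose component at `(i, j)` consists of all operators if `j = g i`, and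
is `0` otherwise. -/
def ofAtoms (g : X.At → Y.At) : Rel X Y := fun i j => ⨆ _ : g i = j, ⊤

lemma mem_ofAtoms {g : X.At → Y.At} {i : X.At} (t : X.space i →ₗ[ℂ] Y.space (g i)) :
    t ∈ ofAtoms g i (g i) := by
  simp [ofAtoms]

lemma eq_zero_of_mem_ofAtoms {g : X.At → Y.At} {i : X.At} {j : Y.At} (h : g i ≠ j)
    {t : X.space i →ₗ[ℂ] Y.space j} (ht : t ∈ ofAtoms g i j) : t = 0 := by
  simpa [ofAtoms, h] using ht

lemma ofAtoms_le_iff {g : X.At → Y.At} {Q : Rel X Y} :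
    ofAtoms g ≤ Q ↔ ∀ i t, t ∈ Q i (g i) := by
  constructor
  · exact fun h i t => h _ _ (mem_ofAtoms t)
  · exact fun h i j => iSup_le fun hij => hij ▸ fun t _ => h i t

end Rel

/-! ### Classical functions to one-dimensional atoms -/

section OneDim

variable {V E : Type*} [NormedAddCommGroup V] [InnerProductSpace ℂ V] [FiniteDimensional ℂ V]
  [NormedAddCommGroup E] [InnerProductSpace ℂ E] [FiniteDimensional ℂ E]

lemma exists_unit_of_finrank_eq_one (hE : Module.finrank ℂ E = 1) :
    ∃ e : E, ‖e‖ = 1 ∧ ∀ y, inner ℂ e y • e = y := by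
  let b := (stdOrthonormalBasis ℂ E).reindex (finCongr hE)
  refine ⟨b 0, b.orthonormal.1 0, fun y => ?_⟩
  simpa using b.sum_repr' y

/-- `x ↦ e ⊗ x` is isometric as `‖e‖ = 1`, and onto as `y ⊗ x = e ⊗ ⟨e, y⟩ x`. -/
lemma isSimilitude_mk {e : E} (he : ‖e‖ = 1) (h : ∀ y, inner ℂ e y • e = y) :
    IsSimilitude (TensorProduct.mk ℂ E V e) := by
  refine ⟨⟨1, one_ne_zero, ?_⟩, ?_⟩
  · rw [one_smul, ← sub_eq_zero, ← inner_map_self_eq_zero]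
    intro x
    simp [inner_sub_left, LinearMap.adjoint_inner_left, he]
  · rw [← LinearMap.range_eq_top, eq_top_iff, ← TensorProduct.span_tmul_eq_top,
      Submodule.span_le]
    rintro _ ⟨y, x, rfl⟩
    refine ⟨inner ℂ e y • x, ?_⟩
    rw [TensorProduct.mk_apply, ← TensorProduct.smul_tmul, h]

end OneDim

section ToClassical

variable (hY : ∀ j, Module.finrank ℂ (Y.space j) = 1)

include hY

/-- For an orthonormal basis `b` and a unit vector `e` of the target, the operators `a k = ⟨b k, ·⟩
e` satisfy `∑ (a k)† (a k) = 1`. Conversely, every operator on a one-dimensional space is scalar. -/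
lemma Rel.isFunction_ofAtoms (g : X.At → Y.At) : (Rel.ofAtoms g : Rel X Y).IsFunction := by
  refine ⟨Rel.id_le_iff.2 fun i => ?_, Rel.comp_le_iff.2 fun j i j' s hs r hr => ?_⟩
  · obtain ⟨e, he, -⟩ := exists_unit_of_finrank_eq_one (hY (g i))
    let b := stdOrthonormalBasis ℂ (X.space i)
    let a := fun k => (innerₛₗ ℂ (b k)).smulRight e
    have hid : (LinearMap.id : X.space i →ₗ[ℂ] X.space i) =
        ∑ k, LinearMap.adjoint (a k) ∘ₗ a k := by
      ext x
      refine ext_inner_left ℂ fun y => ?_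
      have h1 : inner ℂ e e = (1 : ℂ) := by simp [inner_self_eq_norm_sq_to_K, he]
      simp only [LinearMap.sum_apply, inner_sum, LinearMap.comp_apply,
        LinearMap.adjoint_inner_right, LinearMap.id_apply, a, LinearMap.smulRight_apply,
        inner_smul_left, inner_smul_right, h1]
      rw [← b.sum_inner_mul_inner y x]
      refine Finset.sum_congr rfl fun k _ => ?_
      simp [mul_comm]
    rw [hid]
    exact Submodule.sum_mem _ fun k _ =>
      Rel.mem_comp (Rel.adjoint_mem_dagger (Rel.mem_ofAtoms (a k))) (Rel.mem_ofAtoms (a k))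
  · obtain ⟨r, hr, rfl⟩ := hr
    by_cases hj : g i = j
    · by_cases hj' : g i = j'
      · subst hj
        subst hj'
        obtain ⟨e, he, h⟩ := exists_unit_of_finrank_eq_one (hY (g i))
        refine Rel.mem_id_self.2 ⟨inner ℂ e ((s ∘ₗ LinearMap.adjoint r) e), ?_⟩
        ext y
        conv_lhs => rw [← h y, map_smul]
        conv_rhs => rw [← h y]
        have := h (s (LinearMap.adjoint r e))
        simp only [LinearMap.comp_apply, LinearMap.smul_apply,
          LinearMap.id_apply] at this ⊢
        rw [smul_comm, this]
        rfl
      · rw [Rel.eq_zero_of_mem_ofAtoms hj' hs]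
        simp
    · rw [Rel.eq_zero_of_mem_ofAtoms hj hr]
      simp

/-- The function that sends each atom of `X` to an atom of `Y`, for one-dimensional atoms
of `Y`. -/
def ofAtoms (g : X.At → Y.At) : X ⟶ Y :=
  (⟨Rel.ofAtoms g, Rel.isFunction_ofAtoms hY g⟩ : Fun X Y)

lemma isClassical_ofAtoms (g : X.At → Y.At) : IsClassical (ofAtoms hY g) := by
  choose e he h using fun j => exists_unit_of_finrank_eq_one (hY j)
  have he' : ∀ j, inner ℂ (e j) (e j) = (1 : ℂ) := fun j => by
    simp [inner_self_eq_norm_sq_to_K, he]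
  -- The joint function is `x ↦ e ⊗ x`, with `e` a unit vector of the target atom.
  let U : ∀ i, X.space i →ₗ[ℂ] (Y.prod X).space (pair (g i) i) := fun i => tmulLeft (e (g i)) i
  refine ⟨ofMaps (fun i => pair (g i) i) U (fun i => isSimilitude_mk (he _) (h _)), ?_, ?_⟩
  · apply le_antisymm
    · refine Rel.comp_le_iff.2 fun i p j s hs r hr => ?_
      by_cases hp : pair (g i) i = p
      · subst hp
        by_cases hj : g i = j
        · subst hj
          exact Rel.mem_ofAtoms _
        · rw [Rel.eq_zero_of_mem_fst hj hs, LinearMap.zero_comp]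
          exact zero_mem _
      · rw [Rel.eq_zero_of_mem_ofMaps hp hr, LinearMap.comp_zero]
        exact zero_mem _
    · refine Rel.ofAtoms_le_iff.2 fun i t => ?_
      -- Discarding `x` from `e ⊗ x` by the functional `⟨e, t ·⟩` leaves `⟨e, t x⟩ e = t x`.
      have hm := Rel.mem_comp (Rel.fstMap_mem (g i) i (innerₛₗ ℂ (e (g i)) ∘ₗ t))
        (Rel.mem_ofMaps (U := U) i)
      refine mem_submodule_of_eq (LinearMap.ext fun x => ?_) hm
      exact (h _ _).symm
  · apply le_antisymm
    · refine Rel.comp_le_iff.2 fun i p j s hs r hr => ?_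
      by_cases hp : pair (g i) i = p
      · subst hp
        obtain ⟨c, rfl⟩ := Rel.exists_smul_of_mem_ofMaps hr
        rw [Rel.snd_eq] at hs
        rw [LinearMap.comp_smul]
        refine Submodule.smul_mem _ _ ?_
        induction hs using Submodule.span_induction with
        | zero => rw [LinearMap.zero_comp]; exact zero_mem _
        | add s t _ _ hs ht => rw [LinearMap.add_comp]; exact add_mem hs ht
        | smul c s _ hs => rw [LinearMap.smul_comp]; exact Submodule.smul_mem _ _ hs
        | mem s hs =>
          obtain ⟨φ, hij, rfl⟩ := hs
          obtain rfl : i = j := hij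
          exact Rel.mem_id_self.2 ⟨φ (e (g i)), rfl⟩
      · rw [Rel.eq_zero_of_mem_ofMaps hp hr, LinearMap.comp_zero]
        exact zero_mem _
    · refine Rel.id_le_iff.2 fun i => ?_
      have hm := Rel.mem_comp (Rel.sndMap_mem (g i) i (innerₛₗ ℂ (e (g i))))
        (Rel.mem_ofMaps (U := U) i)
      refine mem_submodule_of_eq (LinearMap.ext fun x => ?_) hm
      change x = (inner ℂ (e (g i)) (e (g i)) : ℂ) • x
      rw [he', one_smul]

/-- A nonzero operator of the joint function `G` out of atom `i` lands in some `Y j ⊗ X i'`. As `Y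
j` is a line, the second projection loses nothing, so `P₂ ∘ G = I` forces `i' = i` and makes the
operator a multiple of `e ⊗ ·`. The first projection then produces every operator from `X i` to `Y
j`. -/
lemma IsClassical.exists_eq_ofAtoms {F : X ⟶ Y} (hF : IsClassical F) :
    ∃ g : X.At → Y.At, F = ofAtoms hY g := by
  obtain ⟨G, h₁, h₂⟩ := hF
  have key : ∀ i, ∃ j, ∀ t, t ∈ rel F i j := by
    intro i
    have hex : ∃ p, ∃ r ∈ rel G i p, r ≠ 0 := by
      by_contra! hex
      have hz : (rel G).dagger.comp (rel G) i i ≤ ⊥ := Submodule.span_le.2 (by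
        rintro _ ⟨p, s, -, r, hr, rfl⟩
        rw [hex p r hr, LinearMap.comp_zero]
        exact zero_mem _)
      obtain ⟨x, hx⟩ := exists_ne (0 : X.space i)
      exact hx (LinearMap.congr_fun (hz (Rel.id_le_iff.1 (isFunction_rel G).1 i)) x)
    obtain ⟨p, r, hr, hr0⟩ := hex
    obtain ⟨j, i', rfl⟩ := exists_pair p
    obtain ⟨e, he, h⟩ := exists_unit_of_finrank_eq_one (hY j)
    have hsr := Rel.mem_comp (Rel.sndMap_mem j i' (innerₛₗ ℂ e)) hr
    rw [h₂] at hsr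
    have hrec : tmulLeft e i' ∘ₗ sndMap j i' (innerₛₗ ℂ e) = LinearMap.id := by
      refine prod_ext fun y x => ?_
      change e ⊗ₜ[ℂ] ((inner ℂ e y : ℂ) • x) = y ⊗ₜ[ℂ] x
      rw [← TensorProduct.smul_tmul, h]
    have hr' : r = tmulLeft e i' ∘ₗ (sndMap j i' (innerₛₗ ℂ e) ∘ₗ r) := by
      rw [← LinearMap.comp_assoc, hrec, LinearMap.id_comp]
    have hi : i = i' := by
      by_contra hi
      refine hr0 ?_
      have h0 : sndMap j i' (innerₛₗ ℂ e) ∘ₗ r = 0 := Rel.eq_zero_of_mem_id hi hsr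
      rw [hr', h0, LinearMap.comp_zero]
    subst hi
    obtain ⟨c, hc⟩ := Rel.mem_id_self.1 hsr
    have hc' : r = c • tmulLeft e i := by
      rw [hr']
      exact (congrArg (fun q => tmulLeft e i ∘ₗ q) hc).trans (LinearMap.comp_smul _ _ _)
    have hc0 : c ≠ 0 := by
      rintro rfl
      exact hr0 (by rw [hc', zero_smul])
    refine ⟨j, fun t => ?_⟩
    have hm := Rel.mem_comp (Rel.fstMap_mem j i (innerₛₗ ℂ e ∘ₗ t)) hr
    rw [h₁, hc', LinearMap.comp_smul] at hm
    refine mem_submodule_of_eq (LinearMap.ext fun x => ?_) ((Submodule.smul_mem_iff _ hc0).1 hm)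
    exact (h _).symm
  choose g hg using key
  -- One inclusion suffices, since comparable functions are equal.
  exact ⟨g, (hom_ext_of_le (Rel.ofAtoms_le_iff.2 hg)).symm⟩

end ToClassical

/-! ### Indicators of sets of atoms -/

lemma finrank_space_one_sum_one (k : (one.{u, v}.sum one.{u, v}).At) :
    Module.finrank ℂ ((one.{u, v}.sum one.{u, v}).space k) = 1 := by
  have h : Module.finrank ℂ (EuclideanSpace ℂ PUnit.{v + 1}) = 1 := by simp
  match k with
  | Sum.inl _ => exact h
  | Sum.inr _ => exact h

/-- The first atom of `𝟏 ⊎ 𝟏`. -/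
def falseAtom : (one.{u, v}.sum one.{u, v}).At := Sum.inl PUnit.unit

/-- The second atom of `𝟏 ⊎ 𝟏`. -/
def trueAtom : (one.{u, v}.sum one.{u, v}).At := Sum.inr PUnit.unit

lemma eq_falseAtom_or_eq_trueAtom (k : (one.{u, v}.sum one.{u, v}).At) :
    k = falseAtom ∨ k = trueAtom := by
  match k with
  | Sum.inl _ => exact Or.inl rfl
  | Sum.inr _ => exact Or.inr rfl

lemma falseAtom_ne_trueAtom : falseAtom.{u, v} ≠ trueAtom := Sum.inl_ne_inr

open Classical in
/-- The classical function to `𝟏 ⊎ 𝟏` that indicates a set of atoms. -/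
def indicator (A : Set X.At) : X ⟶ one.{u, v}.sum one.{u, v} :=
  ofAtoms finrank_space_one_sum_one fun i => if i ∈ A then trueAtom else falseAtom

lemma isClassical_indicator (A : Set X.At) : IsClassical (indicator A) :=
  isClassical_ofAtoms _ _

lemma mem_indicator_falseAtom {A : Set X.At} {i : X.At} (hi : i ∉ A)
    (t : X.space i →ₗ[ℂ] (one.{u, v}.sum one.{u, v}).space falseAtom) :
    t ∈ rel (indicator A) i falseAtom := by
  change t ∈ Rel.ofAtoms _ _ _
  simp [Rel.ofAtoms, hi]

lemma eq_zero_of_mem_indicator_falseAtom {A : Set X.At} {i : X.At} (hi : i ∈ A)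
    {t : X.space i →ₗ[ℂ] (one.{u, v}.sum one.{u, v}).space falseAtom}
    (ht : t ∈ rel (indicator A) i falseAtom) : t = 0 :=
  Rel.eq_zero_of_mem_ofAtoms (by simpa [hi] using falseAtom_ne_trueAtom.symm) ht

lemma IsClassical.exists_eq_indicator {F : X ⟶ one.{u, v}.sum one.{u, v}} (hF : IsClassical F) :
    ∃ A, F = indicator A := by
  obtain ⟨g, rfl⟩ := hF.exists_eq_ofAtoms finrank_space_one_sum_one
  refine ⟨{i | g i = trueAtom}, ?_⟩
  congr 1
  ext i
  rcases eq_falseAtom_or_eq_trueAtom (g i) with h | h <;>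
    simp [h, falseAtom_ne_trueAtom]

/-- The constant functions to the second atom of `𝟏 ⊎ 𝟏` are those that vanish on the first. -/
lemma eq_from_comp_inr_iff {F : X ⟶ one.{u, v}.sum one.{u, v}} :
    isTerminalOne.from X ≫ inr one one = F ↔ ∀ i, ∀ t ∈ rel F i falseAtom, t = 0 := by
  constructor
  · rintro rfl i t ht
    have h : rel (isTerminalOne.from X ≫ inr one one) i falseAtom ≤ ⊥ := by
      refine Submodule.span_le.2 ?_
      rintro _ ⟨o, s, hs, r, -, rfl⟩
      obtain rfl : s = 0 := hs
      rw [LinearMap.zero_comp]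
      exact zero_mem _
    exact h ht
  · intro h
    refine (hom_ext_of_le fun i k t ht => ?_).symm
    rcases eq_falseAtom_or_eq_trueAtom k with rfl | rfl
    · rw [h i t ht]
      exact zero_mem _
    · let o : one.{u, v}.At := PUnit.unit
      let s : one.{u, v}.space o →ₗ[ℂ] (one.{u, v}.sum one.{u, v}).space trueAtom :=
        (LinearMap.id : one.{u, v}.space o →ₗ[ℂ] one.{u, v}.space o)
      have h1 : s ∈ rel (inr one.{u, v} one.{u, v}) o trueAtom := Rel.id_mem o
      let r : X.space i →ₗ[ℂ] one.{u, v}.space o := t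
      have h2 : r ∈ rel (isTerminalOne.from X) i o := Submodule.mem_top
      exact Rel.mem_comp h1 h2

/-! ### Supports and the pullback square -/

/-- The set of the atoms of `X` that a function to `X` meets. -/
def support (J : Z ⟶ X) : Set X.At := {i | ∃ z, ∃ r ∈ rel J z i, r ≠ 0}

lemma support_comp_subset (H : W ⟶ Z) (J : Z ⟶ X) : support (H ≫ J) ⊆ support J := by
  rintro i ⟨w, t, ht, ht0⟩
  by_contra hi
  have h : rel (H ≫ J) w i ≤ ⊥ := by
    refine Submodule.span_le.2 ?_
    rintro _ ⟨z, s, hs, r, -, rfl⟩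
    have hs0 : s = 0 := by
      by_contra hs0
      exact hi ⟨z, s, hs, hs0⟩
    rw [hs0, LinearMap.zero_comp]
    exact zero_mem _
  exact ht0 (h ht)

/-- Commutativity means that nothing reaches the false atom. At an atom outside `A` the indicator
contains all operators to the false atom, and these separate points, so `H` must vanish there. -/
lemma from_comp_inr_eq_comp_indicator_iff {H : W ⟶ X} {A : Set X.At} :
    isTerminalOne.from W ≫ inr one one = H ≫ indicator A ↔ support H ⊆ A := by
  rw [eq_from_comp_inr_iff]
  constructor
  · rintro h i ⟨w, r, hr, hr0⟩
    by_contra hi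
    exact hr0 (eq_zero_of_forall_comp_eq_zero r fun φ =>
      h w _ (Rel.mem_comp (mem_indicator_falseAtom hi φ) hr))
  · intro h w t ht
    have h' : rel (H ≫ indicator A) w falseAtom ≤ ⊥ := by
      refine Submodule.span_le.2 ?_
      rintro _ ⟨i, s, hs, r, hr, rfl⟩
      by_cases hr0 : r = 0
      · rw [hr0, LinearMap.comp_zero]
        exact zero_mem _
      · rw [eq_zero_of_mem_indicator_falseAtom (h ⟨w, r, hr, hr0⟩) hs, LinearMap.zero_comp]
        exact zero_mem _
    exact h' ht

/-- If `r ≠ 0` then `r r† ≠ 0`, and `J ∘ J† ≤ I` makes it a scalar. -/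
lemma id_mem_comp_dagger_of_mem_support {J : Z ⟶ X} {i : X.At}
    (hi : i ∈ support J) : LinearMap.id ∈ (rel J).comp (rel J).dagger i i := by
  obtain ⟨z, r, hr, hr0⟩ := hi
  have h := Rel.mem_comp hr (Rel.adjoint_mem_dagger hr)
  obtain ⟨c, hc⟩ := Rel.mem_id_self.1 ((isFunction_rel J).2 _ _ h)
  rw [hc] at h
  refine (Submodule.smul_mem_iff _ ?_).1 h
  rintro rfl
  exact hr0 (comp_adjoint_self_eq_zero (by rw [hc, zero_smul]))

/-- A function to `X` factors through an injective function that meets the same atoms. -/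
lemma IsInjective.exists_lift {J : Z ⟶ X} (hJ : IsInjective J) (H : W ⟶ X)
    (h : support H ⊆ support J) : ∃ L : W ⟶ Z, L ≫ J = H := by
  have hle : rel H ≤ (rel J).comp ((rel J).dagger.comp (rel H)) := by
    intro w i r hr
    by_cases hr0 : r = 0
    · rw [hr0]
      exact zero_mem _
    · rw [← Rel.comp_assoc]
      exact Rel.mem_comp (id_mem_comp_dagger_of_mem_support (h ⟨w, r, hr, hr0⟩)) hr
  -- The lift is `L = J† ∘ H`. Here `L† ∘ L ≥ I` uses the supports through `hle`, and `L ∘ L† ≤ J† ∘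
  -- J ≤ I` uses injectivity of `J`.
  refine ⟨(⟨(rel J).dagger.comp (rel H), ?_, ?_⟩ : Fun W Z), ?_⟩
  · rw [Rel.dagger_comp, Rel.dagger_dagger, Rel.comp_assoc]
    exact (isFunction_rel H).1.trans (Rel.comp_mono le_rfl hle)
  · rw [Rel.dagger_comp, Rel.dagger_dagger, Rel.comp_assoc, ← Rel.comp_assoc (rel H)]
    calc _ ≤ (rel J).dagger.comp ((Rel.id X).comp (rel J)) :=
          Rel.comp_mono le_rfl (Rel.comp_mono (isFunction_rel H).2 le_rfl)
      _ = (rel J).dagger.comp (rel J) := by rw [Rel.id_comp]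
      _ ≤ Rel.id Z := hJ
  · exact (hom_ext_of_le hle).symm

/-- The leg of a cone to `𝟏` carries no information, so a cone is a function with support inside
that of `J`, which lifts along `J`. -/
lemma IsInjective.isPullback {J : Z ⟶ X} (hJ : IsInjective J) :
    IsPullback (isTerminalOne.from Z) J (inr one one) (indicator (support J)) := by
  have := hJ.mono
  have hs : ∀ s : PullbackCone (inr one one) (indicator (support J)),
      ∃ L : s.pt ⟶ Z, L ≫ J = s.snd := by
    refine fun s => hJ.exists_lift s.snd ?_
    rw [← from_comp_inr_eq_comp_indicator_iff, ← s.condition]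
    congr 1
    exact isTerminalOne.hom_ext _ _
  choose L hL using hs
  refine ⟨⟨from_comp_inr_eq_comp_indicator_iff.2 subset_rfl⟩, ⟨PullbackCone.IsLimit.mk _ L
    (fun s => isTerminalOne.hom_ext _ _) hL fun s m _ h => ?_⟩⟩
  rw [← cancel_mono J, h, hL]

/-! ### Subobjects as sets of atoms -/

/-- The quantum set formed by a set of atoms. -/
def restrict (X : QuantumSet.{u, v}) (A : Set X.At) : QuantumSet.{u, v} where
  At := A
  space i := X.space i

/-- The inclusion of a set of atoms. -/
def incl (A : Set X.At) : X.restrict A ⟶ X :=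
  ofMaps (W := X.restrict A) Subtype.val (fun _ => LinearMap.id) fun _ => IsSimilitude.id

lemma isInjective_incl (A : Set X.At) : IsInjective (incl A) :=
  Rel.isInjective_ofMaps (W := X.restrict A) (fun _ => IsSimilitude.id) Subtype.val_injective

lemma support_incl (A : Set X.At) : support (incl A) = A := by
  ext i
  constructor
  · rintro ⟨z, r, hr, hr0⟩
    by_contra hi
    have hz : z.1 ≠ i := fun h => hi (h ▸ z.2)
    exact hr0 (Rel.eq_zero_of_mem_ofMaps (W := X.restrict A) (f := Subtype.val)
      (U := fun _ => LinearMap.id) hz hr)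
  · intro hi
    let z : (X.restrict A).At := ⟨i, hi⟩
    let t : (X.restrict A).space z →ₗ[ℂ] X.space i :=
      (LinearMap.id : X.space i →ₗ[ℂ] X.space i)
    have ht : t ≠ 0 := by
      intro h
      obtain ⟨x, hx⟩ := exists_ne (0 : X.space i)
      exact hx (LinearMap.congr_fun h x)
    exact ⟨z, t, Rel.mem_ofMaps (W := X.restrict A) (f := Subtype.val)
      (U := fun _ => LinearMap.id) z, ht⟩

/-- Commutativity bounds the support by `A`. Conversely the inclusion of `A` is itself a cone, so it
factors through `J`. -/
lemma support_eq_of_isPullback {J : Z ⟶ X} {A : Set X.At}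
    (h : IsPullback (isTerminalOne.from Z) J (inr one one) (indicator A)) : support J = A := by
  refine (from_comp_inr_eq_comp_indicator_iff.1 h.w).antisymm ?_
  have hA := from_comp_inr_eq_comp_indicator_iff.2 (support_incl A).subset
  calc A = support (h.lift _ _ hA ≫ J) := by rw [h.lift_snd, support_incl]
    _ ⊆ support J := support_comp_subset _ _

lemma support_mk_arrow (J : Z ⟶ X) [Mono J] : support (Subobject.mk J).arrow = support J := by
  apply Set.Subset.antisymm
  · rw [← Subobject.underlyingIso_hom_comp_eq_mk]
    exact support_comp_subset _ _
  · refine (congrArg support (Subobject.underlyingIso_arrow J)).superset.trans ?_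
    exact support_comp_subset _ _

/-- Representing arrows are monomorphisms, hence injective, so an inclusion of supports yields a
factorization. -/
lemma support_arrow_injective (X : QuantumSet.{u, v}) :
    Function.Injective fun S : Subobject X => support S.arrow := by
  have key : ∀ S T : Subobject X, support S.arrow ⊆ support T.arrow → S ≤ T := by
    intro S T h
    obtain ⟨L, hL⟩ := (isInjective_of_mono T.arrow).exists_lift S.arrow h
    exact Subobject.le_of_comm L hL
  intro S T h
  exact le_antisymm (key S T h.subset) (key T S h.superset)

/-- The subobjects of `X` correspond to the sets of atoms of `X`. -/
def subobjectEquiv (X : QuantumSet.{u, v}) : Subobject X ≃ Set X.At :=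
  Equiv.ofBijective (fun S => support S.arrow) ⟨support_arrow_injective X, fun A => by
    have := (isInjective_incl A).mono
    exact ⟨Subobject.mk (incl A), (support_mk_arrow _).trans (support_incl A)⟩⟩

/-- `A` is the support of the pullback of `T` along its indicator. -/
lemma indicator_injective : Function.Injective (indicator (X := X)) := by
  intro A B h
  have hA := (isInjective_incl A).isPullback
  rw [support_incl, h] at hA
  rw [← support_eq_of_isPullback hA, support_incl]

/-- The classical functions from `X` to `𝟏 ⊎ 𝟏` correspond to the sets of atoms of `X`. -/
def classicalEquiv (X : QuantumSet.{u, v}) :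
    Set X.At ≃ {F : X ⟶ one.{u, v}.sum one.{u, v} // IsClassical F} :=
  Equiv.ofBijective (fun A => ⟨indicator A, isClassical_indicator A⟩)
    ⟨fun _ _ h => indicator_injective (congrArg Subtype.val h), fun ⟨_, hF⟩ => by
      obtain ⟨A, rfl⟩ := hF.exists_eq_indicator
      exact ⟨A, rfl⟩⟩

end QuantumSet

end

theorem mainTheorem8 :
    (∀ {Z X : QuantumSet.{u, v}} (J : Z ⟶ X), QuantumSet.IsInjective J →
      ∃! F : X ⟶ QuantumSet.one.sum QuantumSet.one,
        QuantumSet.IsClassical F ∧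
          IsPullback (QuantumSet.isTerminalOne.from Z) J
            (QuantumSet.inr QuantumSet.one QuantumSet.one) F) ∧
    (∀ X : QuantumSet.{u, v},
      ∃ e : Subobject X ≃
          {F : X ⟶ QuantumSet.one.sum QuantumSet.one // QuantumSet.IsClassical F},
        ∀ S : Subobject X,
          IsPullback (QuantumSet.isTerminalOne.from (S : QuantumSet.{u, v})) S.arrow
            (QuantumSet.inr QuantumSet.one QuantumSet.one) (e S).1) := by
  refine ⟨fun J hJ => ⟨_, ⟨QuantumSet.isClassical_indicator _, hJ.isPullback⟩, ?_⟩, fun X =>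
    ⟨(QuantumSet.subobjectEquiv X).trans (QuantumSet.classicalEquiv X), fun S =>
      (QuantumSet.isInjective_of_mono S.arrow).isPullback⟩⟩
  rintro F ⟨hF, h⟩
  obtain ⟨A, rfl⟩ := hF.exists_eq_indicator
  rw [QuantumSet.support_eq_of_isPullback h]
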